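/- Let $0<\nu\le\lambda\le\mu<1$, $R\neq 0$, $C=\sqrt{\lambda\nu}$, $F(\xi)=1-\mu\xi$, $G(\xi)=(1-\xi^2)(1-\lambda\xi)(1-\nu\xi)$. The dipole black ring metric is $$ds^2=-\frac{F(x)}{F(y)}\big(dt+RC(1+y)d\psi\big)^2+\frac{R^2}{(x-y)^2}\Big[-F(x)\Big(\frac{G(y)}{F(y)}d\psi^2+\frac{F(y)^2}{G(y)}dy^2\Big)+F(y)^2\Big(\frac{F(x)}{G(x)}dx^2+\frac{G(x)}{F(x)^2}d\phi^2\Big)\Big],$$ considered in the coordinates $(t,y,\psi,x,\phi)$ on the ergoregion $y>1/\nu$, $-1<x<1$ (where $F(y)<0$). Indices $i,j,k,\dots$ range over $y,\psi,x,\phi$, and round brackets denote symmetrization with unit weight. (a) On the ergoregion there are unique $t$-independent $h_{ij}$ (symmetric), $\Phi$, $A_i$ with $ds^2=e^{\Phi/\sqrt3}h_{ij}dx^idx^j+e^{-2\Phi/\sqrt3}(dt+A_idx^i)^2$ (Kaluza–Klein reduction along $\partial_t$), namely $e^{-2\Phi/\sqrt3}=F(x)/(-F(y))$, $A=RC(1+y)d\psi$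 and $$h=\Lambda^2\Big(\frac{dx^2}{G(x)}-\frac{dy^2}{G(y)}+\frac{G(x)}{F(x)^3}d\phi^2-\frac{G(y)}{F(y)^3}d\psi^2\Big),\qquad \Lambda^2=\sqrt{\frac{F(x)}{-F(y)}}\,\frac{R^2F(y)^2F(x)}{(x-y)^2},$$ where $\Lambda>0$ is differentiable. (b) For $S=p_\phi\phi+p_\psi\psi+S_x(x)+S_y(y)$ (energy $E=0$, mass $m=0$) with $S_x$, $S_y$ differentiable, the Hamilton–Jacobi equation $\partial_sS+\frac12g^{\mu\nu}\partial_\mu S\,\partial_\nu S=0$ holds on the ergoregion if and only if for some constant $c$ $$G(y)S_y'(y)^2+\frac{F(y)^3}{G(y)}p_\psi^2=c=G(x)S_x'(x)^2+\frac{F(x)^3}{G(x)}p_\phi^2 .$$ The right- and left-hand sides are $K_{(1)}^{ij}p_ip_j$ and $K_{(2)}^{ij}p_ip_j$, where the only non-zero components are $K_{(1)}^{xx}=G(x)$, $K_{(1)}^{\phi\phi}=F(x)^3/G(x)$, $K_{(2)}^{yy}=G(y)$, $K_{(2)}^{\psi\psi}=F(y)^3/G(y)$. A covector $p$ with $p_t=0$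 is null for the ring metric if and only if $(p_i)$ is null for $h$. (c) Let $\Lambda(x,y)$ be the factor in (a), or more generally any positive differentiable function of $(x,y)$ on $-1<x<1$, $y>1/\nu$, let $h$ be the metric displayed in (a) with this $\Lambda$, and let $\nabla$ be its Levi-Civita connection. Then on the ergoregion: 1. $K_{(1)}^{ij}-K_{(2)}^{ij}=\Lambda^2h^{ij}$. 2. $K=K_{(1)}+K_{(2)}$ is a conformal Killing tensor: $\nabla_{(i}K_{jk)}=\hat\omega_{(i}h_{jk)}$ with $\hat\omega=2\Lambda(\partial_x\Lambda\,dx-\partial_y\Lambda\,dy)$. 3. The antisymmetric tensor with non-zero components $k^{x\phi}=-k^{\phi x}=\sqrt{F(x)^3}/\Lambda$, $k^{y\psi}=-k^{\psi y}=\sqrt{-F(y)^3}/\Lambda$ satisfies $K^{ij}=k^{ik}k^{jl}h_{kl}$, and lowering its indices gives the 2-form $$k=\Lambda^3\Big(\frac{1}{\sqrt{F(x)^3}}dx\wedge d\phi-\frac1{\sqrt{-F(y)^3}}dy\wedge d\psi\Big).$$ 4. $k$ is a conformal Killing–Yano tensor: $\nabla_{(i}k_{j)l}=h_{ij}\hat\xi_l-\hat\xi_{(i}h_{j)l}$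 with $\hat\xi=\frac{G(x)}{\sqrt{F(x)^3}}\partial_x\Lambda\,d\phi+\frac{G(y)}{\sqrt{-F(y)^3}}\partial_y\Lambda\,d\psi$. 5. The Hodge dual of $k$ (orientation $dy\wedge d\psi\wedge dx\wedge d\phi$) is $\Lambda^3\big(\frac{1}{\sqrt{F(x)^3}}dx\wedge d\phi+\frac1{\sqrt{-F(y)^3}}dy\wedge d\psi\big)$, and it satisfies a conformal Killing–Yano equation of the same form, with some 1-form in place of $\hat\xi$. -/

import Mathlib

open scoped Matrix

noncomputable section

namespace DipoleRing

/-! ### Tensor calculus in a coordinate chart of `ℝⁿ` -/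

/-- Fields of `n × n` component matrices: rank-two tensor fields in a coordinate chart. -/
abbrev Tensor2 (n : ℕ) := (Fin n → ℝ) → Matrix (Fin n) (Fin n) ℝ

/-- The partial derivative `∂_i f` at the point `p`. -/
def pd {n : ℕ} (i : Fin n) (f : (Fin n → ℝ) → ℝ) (p : Fin n → ℝ) : ℝ :=
  deriv (fun s => f (Function.update p i s)) (p i)

/-- Christoffel symbols `Γ^k_{ij}` of the Levi-Civita connection of the metric `h`. -/
def christoffel {n : ℕ} (h : Tensor2 n) (p : Fin n → ℝ) (k i j : Fin n) : ℝ :=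
  (1 / 2) * ∑ l, (h p)⁻¹ k l *
    (pd i (fun q => h q j l) p + pd j (fun q => h q i l) p - pd l (fun q => h q i j) p)

/-- Covariant derivative `∇_i T_{jk}` of a covariant rank-two tensor field. -/
def covDeriv {n : ℕ} (h T : Tensor2 n) (p : Fin n → ℝ) (i j k : Fin n) : ℝ :=
  pd i (fun q => T q j k) p - ∑ l, christoffel h p l i j * T p l k
    - ∑ l, christoffel h p l i k * T p j l

/-- Lowering both indices: `T_{ij} = h_{ik} h_{jl} T^{kl}`. -/
def lower {n : ℕ} (h T : Tensor2 n) : Tensor2 n := fun p => h p * T p * (h p)ᵀ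

/-- Raising both indices: `T^{ij} = h^{ik} h^{jl} T_{kl}`. -/
def raise {n : ℕ} (h T : Tensor2 n) : Tensor2 n := fun p => (h p)⁻¹ * T p * ((h p)⁻¹)ᵀ

/-- Total symmetrization `T_{(ijk)}`. -/
def sym3 {n : ℕ} (T : Fin n → Fin n → Fin n → ℝ) (i j k : Fin n) : ℝ :=
  (1 / 6) * (T i j k + T i k j + T j i k + T j k i + T k i j + T k j i)

/-- Symmetrization `T_{(ij)}`. -/
def sym2 {n : ℕ} (T : Fin n → Fin n → ℝ) (i j : Fin n) : ℝ :=
  (1 / 2) * (T i j + T j i)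

/-- On `U` the covariant tensor field `K` is symmetric and satisfies the conformal Killing
equation `∇_{(i} K_{jk)} = ω_{(i} h_{jk)}`. -/
def IsConformalKilling {n : ℕ} (h K : Tensor2 n) (ω : (Fin n → ℝ) → Fin n → ℝ)
    (U : Set (Fin n → ℝ)) : Prop :=
  ∀ p ∈ U, (K p)ᵀ = K p ∧ ∀ i j k,
    sym3 (covDeriv h K p) i j k = sym3 (fun a b c => ω p a * h p b c) i j k

/-- On `U` the covariant tensor field `k` is a 2-form satisfying the conformal Killing–Yano
equation `∇_{(i} k_{j)l} = h_{ij} ξ_l - ξ_{(i} h_{j)l}`. -/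
def IsConformalKillingYano {n : ℕ} (h k : Tensor2 n) (ξ : (Fin n → ℝ) → Fin n → ℝ)
    (U : Set (Fin n → ℝ)) : Prop :=
  ∀ p ∈ U, (k p)ᵀ = -k p ∧ ∀ i j l,
    sym2 (fun a b => covDeriv h k p a b l) i j
      = h p i j * ξ p l - sym2 (fun a b => ξ p a * h p b l) i j

/-- The Levi-Civita symbol on four indices, with `ε_{0123} = 1`. -/
def leviCivita (a b c d : Fin 4) : ℝ :=
  Matrix.det (Matrix.of fun i j : Fin 4 => if ![a, b, c, d] i = j then (1 : ℝ) else 0)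

/-- The Hodge dual `(*k)_{ij} = ½ √|det h| ε_{ijab} k^{ab}` of a 2-form in four dimensions. -/
def hodgeDual (h k : Tensor2 4) : Tensor2 4 := fun p => Matrix.of fun i j =>
  (1 / 2) * √|(h p).det| * ∑ a, ∑ b, leviCivita i j a b * raise h k p a b

/-- Components of `dx^i ∧ dx^j`, or of `∂_i ∧ ∂_j`. -/
def wedge {n : ℕ} (i j : Fin n) : Matrix (Fin n) (Fin n) ℝ :=
  Matrix.single i j 1 - Matrix.single j i 1

/-! ### The dipole black ring

Coordinates on the five-dimensional space-time are `(t, y, ψ, x, φ)`, numbered `0, …, 4`;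
coordinates on the reduced space-time are `(y, ψ, x, φ)`, numbered `0, …, 3`. -/

def F (μ ξ : ℝ) : ℝ := 1 - μ * ξ

def G (lam ν ξ : ℝ) : ℝ := (1 - ξ ^ 2) * (1 - lam * ξ) * (1 - ν * ξ)

/-- The ergoregion `1/ν < y < ∞`, off the axis `x = ± 1` where the coordinates degenerate. -/
def ergoregion (ν : ℝ) : Set (Fin 4 → ℝ) := {p | 1 / ν < p 0 ∧ p 2 ∈ Set.Ioo (-1 : ℝ) 1}

/-- The same region in the five-dimensional space-time. -/
def ergoregion5 (ν : ℝ) : Set (Fin 5 → ℝ) := {q | Fin.tail q ∈ ergoregion ν}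

/-- The gauge field `R √(λν) (1 + y) dψ`. -/
def gaugeA (lam ν R : ℝ) (p : Fin 4 → ℝ) : Fin 4 → ℝ :=
  ![0, R * √(lam * ν) * (1 + p 0), 0, 0]

/-- The five-dimensional dipole ring metric
`-F(x)/F(y) (dt + R √(λν) (1+y) dψ)² + R²/(x-y)² [-F(x) (G(y)/F(y) dψ² + F(y)²/G(y) dy²)
  + F(y)² (F(x)/G(x) dx² + G(x)/F(x)² dφ²)]`. -/
def ringMetric (μ lam ν R : ℝ) : Tensor2 5 := fun q =>
  let y := q 1
  let x := q 3
  let θ : Fin 5 → ℝ := ![1, 0, R * √(lam * ν) * (1 + y), 0, 0]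
  (-(F μ x / F μ y)) • Matrix.vecMulVec θ θ
    + (R ^ 2 / (x - y) ^ 2) • Matrix.diagonal
      ![0,
        -(F μ x * (F μ y ^ 2 / G lam ν y)),
        -(F μ x * (G lam ν y / F μ y)),
        F μ y ^ 2 * (F μ x / G lam ν x),
        F μ y ^ 2 * (G lam ν x / F μ x ^ 2)]

/-- `(h, Φ, A)` is a Kaluza–Klein reduction of `g` along the zeroth coordinate `t` over `U`:
`ds² = e^{Φ/√3} h_{ij} dx^i dx^j + e^{-2Φ/√3} (dt + A_i dx^i)²`, where `h`, `Φ`, `A` do not depend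
on `t`; the line elements are compared on every tangent vector `v`. -/
def IsKaluzaKleinReduction {n : ℕ} (g : Tensor2 (n + 1)) (h : Tensor2 n) (Φ : (Fin n → ℝ) → ℝ)
    (A : (Fin n → ℝ) → Fin n → ℝ) (U : Set (Fin n → ℝ)) : Prop :=
  ∀ p ∈ U, (h p)ᵀ = h p ∧ ∀ (t : ℝ) (v : Fin (n + 1) → ℝ),
    v ⬝ᵥ (g (Fin.cons t p) *ᵥ v)
      = Real.exp (Φ p / √3) * (Fin.tail v ⬝ᵥ (h p *ᵥ Fin.tail v))
        + Real.exp (-2 * Φ p / √3) * (v 0 + A p ⬝ᵥ Fin.tail v) ^ 2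

/-- The four-dimensional metric
`Λ(x,y)² (dx²/G(x) - dy²/G(y) + G(x)/F(x)³ dφ² - G(y)/F(y)³ dψ²)`. -/
def reducedMetric (μ lam ν : ℝ) (Λ : ℝ → ℝ → ℝ) : Tensor2 4 := fun p =>
  let y := p 0
  let x := p 2
  (Λ x y ^ 2) • Matrix.diagonal
    ![-(1 / G lam ν y), -(G lam ν y / F μ y ^ 3), 1 / G lam ν x, G lam ν x / F μ x ^ 3]

/-- The conformal factor of the reduced dipole ring:
`Λ² = √(F(x)/(-F(y))) R² F(y)² F(x)/(x-y)²`, with `Λ ≥ 0`. -/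
def ringFactor (μ R x y : ℝ) : ℝ :=
  √(√(F μ x / -F μ y) * (R ^ 2 * F μ y ^ 2 * F μ x / (x - y) ^ 2))

/-- The scalar `Φ` with `e^{-2Φ/√3} = F(x)/(-F(y))`. -/
def ringPhi (μ : ℝ) (p : Fin 4 → ℝ) : ℝ :=
  -(√3 / 2) * Real.log (F μ (p 2) / -F μ (p 0))

/-- A positive differentiable conformal factor `Λ(x, y)` on `-1 < x < 1`, `y > 1/ν`. -/
def IsConformalFactor (ν : ℝ) (Λ : ℝ → ℝ → ℝ) : Prop :=
  (∀ x ∈ Set.Ioo (-1 : ℝ) 1, ∀ y ∈ Set.Ioi (1 / ν), 0 < Λ x y) ∧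
  DifferentiableOn ℝ (fun z : ℝ × ℝ => Λ z.1 z.2) (Set.Ioo (-1 : ℝ) 1 ×ˢ Set.Ioi (1 / ν))

/-! ### The Hamilton–Jacobi equation -/

/-- `S(s, q)` solves `∂S/∂s + ½ g^{μν} ∂_μ S ∂_ν S = 0` on `U`. -/
def IsHamiltonJacobiSolution {n : ℕ} (g : Tensor2 n) (S : ℝ → (Fin n → ℝ) → ℝ)
    (U : Set (Fin n → ℝ)) : Prop :=
  ∀ s : ℝ, ∀ q ∈ U, deriv (fun r => S r q) s
    + (1 / 2) * ∑ a, ∑ b, (g q)⁻¹ a b * pd a (S s) q * pd b (S s) q = 0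

/-- `S = ½ m² s - E t + p_φ φ + p_ψ ψ + S_x(x) + S_y(y)`. -/
def separableAction (m E pφ pψ : ℝ) (Sx Sy : ℝ → ℝ) (s : ℝ) (q : Fin 5 → ℝ) : ℝ :=
  (1 / 2) * m ^ 2 * s - E * q 0 + pφ * q 4 + pψ * q 2 + Sx (q 3) + Sy (q 1)

/-! ### The hidden-symmetry tensors -/

/-- `K₍₁₎^{xx} = G(x)`, `K₍₁₎^{φφ} = F(x)³/G(x)`. -/
def K1 (μ lam ν : ℝ) : Tensor2 4 := fun p =>
  Matrix.diagonal ![0, 0, G lam ν (p 2), F μ (p 2) ^ 3 / G lam ν (p 2)]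

/-- `K₍₂₎^{yy} = G(y)`, `K₍₂₎^{ψψ} = F(y)³/G(y)`. -/
def K2 (μ lam ν : ℝ) : Tensor2 4 := fun p =>
  Matrix.diagonal ![G lam ν (p 0), F μ (p 0) ^ 3 / G lam ν (p 0), 0, 0]

/-- `K^{ij} = K₍₁₎^{ij} + K₍₂₎^{ij}`. -/
def KUp (μ lam ν : ℝ) : Tensor2 4 := K1 μ lam ν + K2 μ lam ν

/-- `∂Λ/∂x`. -/
def dxΛ (Λ : ℝ → ℝ → ℝ) (x y : ℝ) : ℝ := deriv (fun s => Λ s y) x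

/-- `∂Λ/∂y`. -/
def dyΛ (Λ : ℝ → ℝ → ℝ) (x y : ℝ) : ℝ := deriv (fun s => Λ x s) y

/-- `ω = 2 Λ (∂_x Λ dx - ∂_y Λ dy)`. -/
def omegaForm (Λ : ℝ → ℝ → ℝ) (p : Fin 4 → ℝ) : Fin 4 → ℝ :=
  let y := p 0
  let x := p 2
  ![-(2 * Λ x y * dyΛ Λ x y), 0, 2 * Λ x y * dxΛ Λ x y, 0]

/-- `k^{xφ} = -k^{φx} = √(F(x)³)/Λ`, `k^{yψ} = -k^{ψy} = √(-F(y)³)/Λ`. -/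
def kUp (μ : ℝ) (Λ : ℝ → ℝ → ℝ) : Tensor2 4 := fun p =>
  let y := p 0
  let x := p 2
  (√(F μ x ^ 3) / Λ x y) • wedge 2 3 + (√(-F μ y ^ 3) / Λ x y) • wedge 0 1

/-- `k = Λ³ (dx ∧ dφ / √(F(x)³) - dy ∧ dψ / √(-F(y)³))`. -/
def kForm (μ : ℝ) (Λ : ℝ → ℝ → ℝ) : Tensor2 4 := fun p =>
  let y := p 0
  let x := p 2
  (Λ x y ^ 3) • ((1 / √(F μ x ^ 3)) • wedge 2 3 - (1 / √(-F μ y ^ 3)) • wedge 0 1)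

/-- `ξ = G(x)/√(F(x)³) ∂_x Λ dφ + G(y)/√(-F(y)³) ∂_y Λ dψ`. -/
def xiForm (μ lam ν : ℝ) (Λ : ℝ → ℝ → ℝ) (p : Fin 4 → ℝ) : Fin 4 → ℝ :=
  let y := p 0
  let x := p 2
  ![0, G lam ν y / √(-F μ y ^ 3) * dyΛ Λ x y, 0, G lam ν x / √(F μ x ^ 3) * dxΛ Λ x y]

/-- `Λ³ (dx ∧ dφ / √(F(x)³) + dy ∧ dψ / √(-F(y)³))`. -/
def kDualForm (μ : ℝ) (Λ : ℝ → ℝ → ℝ) : Tensor2 4 := fun p =>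
  let y := p 0
  let x := p 2
  (Λ x y ^ 3) • ((1 / √(F μ x ^ 3)) • wedge 2 3 + (1 / √(-F μ y ^ 3)) • wedge 0 1)

end DipoleRing

end

open scoped Matrix

noncomputable section

namespace DipoleRing

/-! ### Partial derivatives and covariant derivatives in a chart -/

/-! On the ergoregion F(x) > 0 > F(y), so u = √(F(x)³) and w = √(-F(y)³) are real and the reduced
metric is Λ² (dx²/a + a/u² dφ² - dy²/b + b/w² dψ²) with a = G(x), b = G(y). For Λ = 1 this is a
product of two surfaces with area forms dx ∧ dφ/u and dy ∧ dψ/w, up to sign. Those forms and the two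
factor metrics are parallel. Rescaling the metric by Λ² turns a parallel 2-form, multiplied by Λ³,
into a conformal Killing–Yano form, while the contravariant tensor K stays conformal Killing; this
is why Λ may be arbitrary. The code checks both equations by components from the Christoffel
symbols, for general a, u, b, w: `isConformalKillingYano_sepYano` and
`isConformalKilling_sepKilling`. Only w² enters the metric, so w ↦ -w gives the equation for the
Hodge dual at no extra cost. At zero energy the gauge potential drops out of the inverse ring
metric, and g^{μν} p_μ p_ν is a nonzero factor times a function of x minus a function of y
(`dotProduct_ringMetric_inv_mulVec`). This yields both the separation of the Hamilton–Jacobi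
equation and the correspondence of null covectors. Uniqueness of the reduction is read off by
testing the line element on suitable vectors. -/

lemma pd_congr {n : ℕ} {U : Set (Fin n → ℝ)} (hU : IsOpen U) {f g : (Fin n → ℝ) → ℝ}
    (hfg : ∀ q ∈ U, f q = g q) {p : Fin n → ℝ} (hp : p ∈ U) (i : Fin n) :
    pd i f p = pd i g p := by
  unfold pd
  apply Filter.EventuallyEq.deriv_eq
  have hc : Continuous fun s : ℝ => Function.update p i s :=
    continuous_const.update i continuous_id
  have hmem : (fun s : ℝ => Function.update p i s) ⁻¹' U ∈ nhds (p i) :=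
    (hU.preimage hc).mem_nhds (by simpa using hp)
  filter_upwards [hmem] with s hs using hfg _ hs

/-- Derivatives are local, so agreement on an open set suffices. The ring tensors match their
separable models only where F has the right signs, hence the transfer lemmas are relative to U. -/
lemma covDeriv_congr {n : ℕ} {U : Set (Fin n → ℝ)} (hU : IsOpen U) {h h' T T' : Tensor2 n}
    (hh : ∀ q ∈ U, h q = h' q) (hT : ∀ q ∈ U, T q = T' q) {p : Fin n → ℝ} (hp : p ∈ U) :
    covDeriv h T p = covDeriv h' T' p := by
  have e₁ : ∀ i j k, pd i (fun q => h q j k) p = pd i (fun q => h' q j k) p :=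
    fun i j k => pd_congr hU (fun q hq => by rw [hh q hq]) hp i
  have e₂ : ∀ i j k, pd i (fun q => T q j k) p = pd i (fun q => T' q j k) p :=
    fun i j k => pd_congr hU (fun q hq => by rw [hT q hq]) hp i
  funext i j k
  simp only [covDeriv, christoffel, e₁, e₂, hh p hp, hT p hp]

lemma IsConformalKilling.congr {n : ℕ} {U : Set (Fin n → ℝ)} (hU : IsOpen U)
    {h h' K K' : Tensor2 n} {ω ω' : (Fin n → ℝ) → Fin n → ℝ}
    (hK : IsConformalKilling h K ω U) (hh : ∀ q ∈ U, h' q = h q) (hKK : ∀ q ∈ U, K' q = K q)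
    (hω : ∀ q ∈ U, ω' q = ω q) :
    IsConformalKilling h' K' ω' U := by
  intro p hp
  rw [covDeriv_congr hU hh hKK hp, hKK p hp, hh p hp, hω p hp]
  exact hK p hp

lemma IsConformalKillingYano.congr {n : ℕ} {U : Set (Fin n → ℝ)} (hU : IsOpen U)
    {h h' k k' : Tensor2 n} {ξ ξ' : (Fin n → ℝ) → Fin n → ℝ}
    (hk : IsConformalKillingYano h k ξ U) (hh : ∀ q ∈ U, h' q = h q) (hkk : ∀ q ∈ U, k' q = k q)
    (hξ : ∀ q ∈ U, ξ' q = ξ q) :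
    IsConformalKillingYano h' k' ξ' U := by
  intro p hp
  rw [covDeriv_congr hU hh hkk hp, hkk p hp, hh p hp, hξ p hp]
  exact hk p hp

lemma inv_diagonal_of_ne_zero {n : ℕ} {d : Fin n → ℝ} (hd : ∀ i, d i ≠ 0) :
    (Matrix.diagonal d)⁻¹ = Matrix.diagonal fun i => (d i)⁻¹ := by
  apply Matrix.inv_eq_right_inv
  rw [Matrix.diagonal_mul_diagonal, ← Matrix.diagonal_one]
  congr 1
  funext i
  exact mul_inv_cancel₀ (hd i)

lemma pd_zero {n : ℕ} (i : Fin n) (p : Fin n → ℝ) : pd i (fun _ => 0) p = 0 := by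
  simp [pd]

/-- The Christoffel symbols of a diagonal metric. -/
lemma christoffel_diagonal {n : ℕ} {d : (Fin n → ℝ) → Fin n → ℝ} {p : Fin n → ℝ}
    (hd : ∀ i, d p i ≠ 0) (k i j : Fin n) :
    christoffel (fun q => Matrix.diagonal (d q)) p k i j
      = (1 / 2) * (d p k)⁻¹ * ((if j = k then pd i (fun q => d q j) p else 0)
        + (if i = k then pd j (fun q => d q i) p else 0)
        - (if i = j then pd k (fun q => d q i) p else 0)) := by
  have hpd : ∀ a b c : Fin n, pd a (fun q => Matrix.diagonal (d q) b c) p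
      = if b = c then pd a (fun q => d q b) p else 0 := by
    intro a b c
    split_ifs with hbc
    · subst hbc; simp
    · simp [Matrix.diagonal_apply_ne _ hbc, pd_zero]
  simp only [christoffel, hpd, inv_diagonal_of_ne_zero hd]
  rw [Finset.sum_eq_single k]
  · simp [mul_assoc]
  · intro b _ hb
    simp [Matrix.diagonal_apply_ne _ hb.symm]
  · simp

/-- The covariant derivative of a tensor with diagonal component matrix. -/
lemma covDeriv_diagonal {n : ℕ} (h : Tensor2 n) (d : (Fin n → ℝ) → Fin n → ℝ) (p : Fin n → ℝ)
    (i j k : Fin n) :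
    covDeriv h (fun q => Matrix.diagonal (d q)) p i j k
      = pd i (fun q => Matrix.diagonal (d q) j k) p - christoffel h p k i j * d p k
        - christoffel h p j i k * d p j := by
  simp [covDeriv, Matrix.diagonal_apply]

lemma pd_of_two_coords (i : Fin 4) (f : ℝ → ℝ → ℝ) (p : Fin 4 → ℝ) :
    pd i (fun q => f (q 2) (q 0)) p
      = ![deriv (fun s => f (p 2) s) (p 0), 0, deriv (fun s => f s (p 0)) (p 2), 0] i := by
  fin_cases i <;> simp [pd, Function.update]

/-! ### Conformally separable metrics

The metric `Λ(x,y)² (dx²/a(x) + a(x)/u(x)² dφ² - dy²/b(y) + b(y)/w(y)² dψ²)` in the coordinates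
`(y, ψ, x, φ)`. -/

/-- The diagonal components of the conformally separable metric. -/
def sepDiag (Λ : ℝ → ℝ → ℝ) (a u b w : ℝ → ℝ) (p : Fin 4 → ℝ) : Fin 4 → ℝ :=
  ![-(Λ (p 2) (p 0) ^ 2 / b (p 0)), Λ (p 2) (p 0) ^ 2 * b (p 0) / w (p 0) ^ 2,
    Λ (p 2) (p 0) ^ 2 / a (p 2), Λ (p 2) (p 0) ^ 2 * a (p 2) / u (p 2) ^ 2]

/-- The conformally separable metric. -/
def sepMetric (Λ : ℝ → ℝ → ℝ) (a u b w : ℝ → ℝ) : Tensor2 4 :=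
  fun p => Matrix.diagonal (sepDiag Λ a u b w p)

/-- The diagonal components of `Λ⁴ (dx²/a + a/u² dφ² + dy²/b - b/w² dψ²)`. -/
def sepKillingDiag (Λ : ℝ → ℝ → ℝ) (a u b w : ℝ → ℝ) (p : Fin 4 → ℝ) : Fin 4 → ℝ :=
  ![Λ (p 2) (p 0) ^ 4 / b (p 0), -(Λ (p 2) (p 0) ^ 4 * b (p 0) / w (p 0) ^ 2),
    Λ (p 2) (p 0) ^ 4 / a (p 2), Λ (p 2) (p 0) ^ 4 * a (p 2) / u (p 2) ^ 2]

/-- The covariant tensor `Λ⁴ (dx²/a + a/u² dφ² + dy²/b - b/w² dψ²)`. -/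
def sepKilling (Λ : ℝ → ℝ → ℝ) (a u b w : ℝ → ℝ) : Tensor2 4 :=
  fun p => Matrix.diagonal (sepKillingDiag Λ a u b w p)

/-- The 2-form `Λ³ (dx ∧ dφ / u - dy ∧ dψ / w)`. -/
def sepYano (Λ : ℝ → ℝ → ℝ) (u w : ℝ → ℝ) : Tensor2 4 := fun p =>
  !![0, -(Λ (p 2) (p 0) ^ 3 / w (p 0)), 0, 0;
     Λ (p 2) (p 0) ^ 3 / w (p 0), 0, 0, 0;
     0, 0, 0, Λ (p 2) (p 0) ^ 3 / u (p 2);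
     0, 0, -(Λ (p 2) (p 0) ^ 3 / u (p 2)), 0]

/-- The 1-form `a/u ∂_x Λ dφ + b/w ∂_y Λ dψ`. -/
def sepXi (Λ : ℝ → ℝ → ℝ) (a u b w : ℝ → ℝ) (p : Fin 4 → ℝ) : Fin 4 → ℝ :=
  ![0, b (p 0) / w (p 0) * dyΛ Λ (p 2) (p 0), 0, a (p 2) / u (p 2) * dxΛ Λ (p 2) (p 0)]

/-- At `p` the data of a conformally separable metric are differentiable and do not vanish. -/
structure IsRegularAt (Λ : ℝ → ℝ → ℝ) (a u b w : ℝ → ℝ) (p : Fin 4 → ℝ) : Prop where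
  Λ_ne : Λ (p 2) (p 0) ≠ 0
  a_ne : a (p 2) ≠ 0
  u_ne : u (p 2) ≠ 0
  b_ne : b (p 0) ≠ 0
  w_ne : w (p 0) ≠ 0
  Λ_diff_x : DifferentiableAt ℝ (fun s => Λ s (p 0)) (p 2)
  Λ_diff_y : DifferentiableAt ℝ (fun s => Λ (p 2) s) (p 0)
  a_diff : DifferentiableAt ℝ a (p 2)
  u_diff : DifferentiableAt ℝ u (p 2)
  b_diff : DifferentiableAt ℝ b (p 0)
  w_diff : DifferentiableAt ℝ w (p 0)

/-! ### Partial derivatives and Christoffel symbols of the separable metric -/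

section

variable {Λ : ℝ → ℝ → ℝ} {a u b w : ℝ → ℝ} {p : Fin 4 → ℝ}

lemma IsRegularAt.sepDiag_ne_zero (H : IsRegularAt Λ a u b w p) (i : Fin 4) :
    sepDiag Λ a u b w p i ≠ 0 := by
  obtain ⟨h1, h2, h3, h4, h5, -⟩ := H
  fin_cases i <;> simp [sepDiag, *]

/-- The exponents that occur are 2 for the metric, 3 for the 2-form and 4 for the covariant Killing
tensor. -/
lemma deriv_pow_div {L g : ℝ → ℝ} {s : ℝ} (hL : DifferentiableAt ℝ L s)
    (hg : DifferentiableAt ℝ g s) (hg0 : g s ≠ 0) (n : ℕ) :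
    deriv (fun s => L s ^ n / g s) s
      = n * L s ^ (n - 1) * deriv L s / g s - L s ^ n * deriv g s / g s ^ 2 := by
  rw [deriv_fun_div (hL.fun_pow n) hg hg0, deriv_fun_pow hL]
  field_simp

lemma deriv_pow_mul_div_sq {L f g : ℝ → ℝ} {s : ℝ} (hL : DifferentiableAt ℝ L s)
    (hf : DifferentiableAt ℝ f s) (hg : DifferentiableAt ℝ g s) (hg0 : g s ≠ 0) (n : ℕ) :
    deriv (fun s => L s ^ n * f s / g s ^ 2) s
      = n * L s ^ (n - 1) * deriv L s * f s / g s ^ 2 + L s ^ n * deriv f s / g s ^ 2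
        - 2 * L s ^ n * f s * deriv g s / g s ^ 3 := by
  rw [deriv_fun_div ((hL.fun_pow n).fun_mul hf) (hg.fun_pow 2) (pow_ne_zero 2 hg0),
    deriv_fun_mul (hL.fun_pow n) hf, deriv_fun_pow hL, deriv_fun_pow hg]
  field_simp
  push_cast
  ring

lemma IsRegularAt.pd_sepDiag (H : IsRegularAt Λ a u b w p) (i j : Fin 4) :
    pd i (fun q => sepDiag Λ a u b w q j) p =
      (let L := Λ (p 2) (p 0); let Lx := dxΛ Λ (p 2) (p 0); let Ly := dyΛ Λ (p 2) (p 0)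
      let A := a (p 2); let A' := deriv a (p 2); let V := u (p 2); let V' := deriv u (p 2)
      let B := b (p 0); let B' := deriv b (p 0); let W := w (p 0); let W' := deriv w (p 0)
      ![![-(2 * L * Ly / B) + L ^ 2 * B' / B ^ 2,
          2 * L * Ly * B / W ^ 2 + L ^ 2 * B' / W ^ 2 - 2 * L ^ 2 * B * W' / W ^ 3,
          2 * L * Ly / A, 2 * L * Ly * A / V ^ 2],
        ![0, 0, 0, 0],
        ![-(2 * L * Lx / B), 2 * L * Lx * B / W ^ 2,
          2 * L * Lx / A - L ^ 2 * A' / A ^ 2,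
          2 * L * Lx * A / V ^ 2 + L ^ 2 * A' / V ^ 2 - 2 * L ^ 2 * A * V' / V ^ 3],
        ![0, 0, 0, 0]] i j) := by
  obtain ⟨h1, h2, h3, h4, h5, hx, hy, ha, hu, hb, hw⟩ := H
  -- The components read only slots 0 and 2, so the zeros put in for ψ and φ are immaterial and the
  -- match is definitional.
  refine (pd_of_two_coords i (fun x y => sepDiag Λ a u b w ![y, 0, x, 0] j) p).trans ?_
  fin_cases i <;> fin_cases j <;>
    simp [sepDiag, dxΛ, dyΛ, deriv_pow_div hx ha h2, deriv_pow_div hy hb h4,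
      deriv_pow_mul_div_sq hx ha hu h3, deriv_pow_mul_div_sq hy hb hw h5, deriv_fun_pow hx,
      deriv_fun_pow hy]
  all_goals ring

lemma IsRegularAt.pd_sepKilling (H : IsRegularAt Λ a u b w p) (i j k : Fin 4) :
    pd i (fun q => sepKilling Λ a u b w q j k) p =
      (let L := Λ (p 2) (p 0); let Lx := dxΛ Λ (p 2) (p 0); let Ly := dyΛ Λ (p 2) (p 0)
      let A := a (p 2); let A' := deriv a (p 2); let V := u (p 2); let V' := deriv u (p 2)
      let B := b (p 0); let B' := deriv b (p 0); let W := w (p 0); let W' := deriv w (p 0)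
      Matrix.diagonal (![![4 * L ^ 3 * Ly / B - L ^ 4 * B' / B ^ 2,
          -(4 * L ^ 3 * Ly * B / W ^ 2) - L ^ 4 * B' / W ^ 2 + 2 * L ^ 4 * B * W' / W ^ 3,
          4 * L ^ 3 * Ly / A, 4 * L ^ 3 * Ly * A / V ^ 2],
        ![0, 0, 0, 0],
        ![4 * L ^ 3 * Lx / B, -(4 * L ^ 3 * Lx * B / W ^ 2),
          4 * L ^ 3 * Lx / A - L ^ 4 * A' / A ^ 2,
          4 * L ^ 3 * Lx * A / V ^ 2 + L ^ 4 * A' / V ^ 2 - 2 * L ^ 4 * A * V' / V ^ 3],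
        ![0, 0, 0, 0]] i) j k) := by
  obtain ⟨h1, h2, h3, h4, h5, hx, hy, ha, hu, hb, hw⟩ := H
  rcases eq_or_ne j k with rfl | hjk
  · refine (pd_of_two_coords i (fun x y => sepKilling Λ a u b w ![y, 0, x, 0] j j) p).trans ?_
    fin_cases i <;> fin_cases j <;>
      simp [sepKilling, sepKillingDiag, dxΛ, dyΛ, deriv_pow_div hx ha h2, deriv_pow_div hy hb h4,
        deriv_pow_mul_div_sq hx ha hu h3, deriv_pow_mul_div_sq hy hb hw h5, deriv_fun_pow hx,
        deriv_fun_pow hy]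
    all_goals ring
  · simp [sepKilling, Matrix.diagonal_apply_ne _ hjk, pd_zero]

lemma IsRegularAt.pd_sepYano (H : IsRegularAt Λ a u b w p) (i j k : Fin 4) :
    pd i (fun q => sepYano Λ u w q j k) p =
      (let L := Λ (p 2) (p 0); let Lx := dxΛ Λ (p 2) (p 0); let Ly := dyΛ Λ (p 2) (p 0)
      let V := u (p 2); let V' := deriv u (p 2); let W := w (p 0); let W' := deriv w (p 0)
      let α := ![3 * L ^ 2 * Ly / W - L ^ 3 * W' / W ^ 2, 0, 3 * L ^ 2 * Lx / W, 0] i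
      let β := ![3 * L ^ 2 * Ly / V, 0, 3 * L ^ 2 * Lx / V - L ^ 3 * V' / V ^ 2, 0] i
      !![0, -α, 0, 0; α, 0, 0, 0; 0, 0, 0, β; 0, 0, -β, 0] j k) := by
  obtain ⟨h1, h2, h3, h4, h5, hx, hy, ha, hu, hb, hw⟩ := H
  refine (pd_of_two_coords i (fun x y => sepYano Λ u w ![y, 0, x, 0] j k) p).trans ?_
  fin_cases j <;> fin_cases k <;> simp [sepYano] <;> fin_cases i <;>
    simp [dxΛ, dyΛ, deriv_pow_div hx hu h3, deriv_pow_div hy hw h5, deriv_fun_pow hx,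
      deriv_fun_pow hy]

/-- The Christoffel symbols of a conformally separable metric. -/
lemma IsRegularAt.christoffel_sepMetric (H : IsRegularAt Λ a u b w p) (k i j : Fin 4) :
    christoffel (sepMetric Λ a u b w) p k i j =
      (let lx := dxΛ Λ (p 2) (p 0) / Λ (p 2) (p 0); let ly := dyΛ Λ (p 2) (p 0) / Λ (p 2) (p 0)
      let A := a (p 2); let A' := deriv a (p 2); let V := u (p 2); let V' := deriv u (p 2)
      let B := b (p 0); let B' := deriv b (p 0); let W := w (p 0); let W' := deriv w (p 0)
      ![!![ly - B' / (2 * B), 0, lx, 0;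
           0, B / W ^ 2 * (ly * B + B' / 2 - B * W' / W), 0, 0;
           lx, 0, B * ly / A, 0;
           0, 0, 0, A * B * ly / V ^ 2],
        !![0, ly + B' / (2 * B) - W' / W, 0, 0;
           ly + B' / (2 * B) - W' / W, 0, lx, 0;
           0, lx, 0, 0;
           0, 0, 0, 0],
        !![A * lx / B, 0, ly, 0;
           0, -(A * B * lx / W ^ 2), 0, 0;
           ly, 0, lx - A' / (2 * A), 0;
           0, 0, 0, -(A / V ^ 2 * (lx * A + A' / 2 - A * V' / V))],
        !![0, 0, 0, ly;
           0, 0, 0, 0;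
           0, 0, 0, lx + A' / (2 * A) - V' / V;
           ly, 0, lx + A' / (2 * A) - V' / V, 0]] k i j) := by
  refine (christoffel_diagonal H.sepDiag_ne_zero k i j).trans ?_
  simp only [H.pd_sepDiag]
  obtain ⟨h1, h2, h3, h4, h5, -, -, -, -, -, -⟩ := H
  simp only [sepDiag]
  fin_cases k <;> fin_cases i <;> fin_cases j <;> simp
  all_goals field_simp
  all_goals ring

/-! ### The two hidden-symmetry equations, component by component -/

set_option maxHeartbeats 4000000 in
-- For Λ = 1 the form is a combination of parallel area forms; the weight Λ³ is the one that
-- conformal rescaling requires, and ξ collects the derivatives of Λ. The signs of a, b, u, w play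
-- no role, only their nonvanishing, which clears denominators in the 64 component identities.
theorem isConformalKillingYano_sepYano {U : Set (Fin 4 → ℝ)}
    (hU : ∀ p ∈ U, IsRegularAt Λ a u b w p) :
    IsConformalKillingYano (sepMetric Λ a u b w) (sepYano Λ u w) (sepXi Λ a u b w) U := by
  intro p hp
  have H := hU p hp
  refine ⟨?_, fun i j l => ?_⟩
  · ext i j
    fin_cases i <;> fin_cases j <;> simp [sepYano]
  · simp only [sym2, covDeriv, H.pd_sepYano, Fin.sum_univ_four, H.christoffel_sepMetric]
    obtain ⟨h1, h2, h3, h4, h5, -, -, -, -, -, -⟩ := H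
    simp only [sepMetric, sepDiag, sepXi, sepYano]
    fin_cases i <;> fin_cases j <;> fin_cases l <;> simp
    all_goals field_simp
    all_goals ring

set_option maxHeartbeats 4000000 in
-- For Λ = 1 the tensor is the difference of the two factor metrics, hence parallel. Its
-- contravariant form does not involve Λ, so lowering both indices produces Λ⁴, and ω vanishes when
-- Λ is constant.
theorem isConformalKilling_sepKilling {U : Set (Fin 4 → ℝ)}
    (hU : ∀ p ∈ U, IsRegularAt Λ a u b w p) :
    IsConformalKilling (sepMetric Λ a u b w) (sepKilling Λ a u b w) (omegaForm Λ) U := by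
  intro p hp
  have H := hU p hp
  refine ⟨by simp [sepKilling], fun i j l => ?_⟩
  have hK := covDeriv_diagonal (sepMetric Λ a u b w) (sepKillingDiag Λ a u b w) p
  have hpd := H.pd_sepKilling
  unfold sepKilling at hpd ⊢
  simp only [sym3, hK, hpd, H.christoffel_sepMetric]
  obtain ⟨h1, h2, h3, h4, h5, -, -, -, -, -, -⟩ := H
  simp only [sepMetric, sepDiag, omegaForm, sepKillingDiag]
  fin_cases i <;> fin_cases j <;> fin_cases l <;> simp
  all_goals field_simp
  all_goals ring

end

/-! ### Signs of the structure functions -/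

lemma isOpen_ergoregion (ν : ℝ) : IsOpen (ergoregion ν) :=
  (isOpen_lt continuous_const (continuous_apply 0)).inter
    (isOpen_Ioo.preimage (continuous_apply (2 : Fin 4)))

lemma F_pos_of_mem_Ioo {μ x : ℝ} (hμ0 : 0 < μ) (hμ : μ < 1) (hx : x ∈ Set.Ioo (-1 : ℝ) 1) :
    0 < F μ x := by
  have := hx.2
  unfold F
  nlinarith

/-- The linear factors of G are themselves values of F, with parameters λ and ν, so the sign of F
settles them. -/
lemma G_pos_of_mem_Ioo {lam ν x : ℝ} (hlam0 : 0 < lam) (hlam : lam < 1) (hν0 : 0 < ν) (hν : ν < 1)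
    (hx : x ∈ Set.Ioo (-1 : ℝ) 1) : 0 < G lam ν x :=
  mul_pos (mul_pos (by nlinarith [hx.1, hx.2]) (F_pos_of_mem_Ioo hlam0 hlam hx))
    (F_pos_of_mem_Ioo hν0 hν hx)

lemma F_neg_of_lt {μ ν y : ℝ} (hν0 : 0 < ν) (hνμ : ν ≤ μ) (hy : 1 / ν < y) : F μ y < 0 := by
  have h1 : 1 < ν * y := by rwa [div_lt_iff₀' hν0] at hy
  have h2 : 0 < y := (by positivity : 0 < 1 / ν).trans hy
  unfold F
  nlinarith

/-- Beyond 1/ν > 1 all three factors 1 - y², 1 - λy and 1 - νy are negative. -/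
lemma G_neg_of_lt {lam ν y : ℝ} (hν0 : 0 < ν) (hν : ν < 1) (hνlam : ν ≤ lam) (hy : 1 / ν < y) :
    G lam ν y < 0 := by
  have h1 : 1 < y := lt_trans ((one_lt_div hν0).2 hν) hy
  exact mul_neg_of_pos_of_neg
    (mul_pos_of_neg_of_neg (by nlinarith) (F_neg_of_lt hν0 hνlam hy)) (F_neg_of_lt hν0 le_rfl hy)

lemma sub_ne_zero_of_lt {ν x y : ℝ} (hν0 : 0 < ν) (hν : ν < 1) (hx : x ∈ Set.Ioo (-1 : ℝ) 1)
    (hy : 1 / ν < y) : x - y ≠ 0 := by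
  have := (one_lt_div hν0).2 hν
  have := hx.2
  linarith

/-! ### The conformal factor of the ring -/

lemma ringFactor_sq {μ R x y : ℝ} (hx : 0 < F μ x) :
    ringFactor μ R x y ^ 2 = √(F μ x / -F μ y) * (R ^ 2 * F μ y ^ 2 * F μ x / (x - y) ^ 2) :=
  Real.sq_sqrt (by positivity)

lemma isConformalFactor_ringFactor {μ ν R : ℝ} (hν0 : 0 < ν) (hνμ : ν ≤ μ) (hμ : μ < 1)
    (hR : R ≠ 0) : IsConformalFactor ν (ringFactor μ R) := by
  have key : ∀ x ∈ Set.Ioo (-1 : ℝ) 1, ∀ y ∈ Set.Ioi (1 / ν),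
      0 < F μ x ∧ 0 < -F μ y ∧ x - y ≠ 0 := fun x hx y hy =>
    ⟨F_pos_of_mem_Ioo (hν0.trans_le hνμ) hμ hx, neg_pos.2 (F_neg_of_lt hν0 hνμ hy),
      sub_ne_zero_of_lt hν0 (hνμ.trans_lt hμ) hx hy⟩
  have hpos : ∀ x ∈ Set.Ioo (-1 : ℝ) 1, ∀ y ∈ Set.Ioi (1 / ν),
      0 < √(F μ x / -F μ y) * (R ^ 2 * F μ y ^ 2 * F μ x / (x - y) ^ 2) := by
    intro x hx y hy
    obtain ⟨h1, h2, h3⟩ := key x hx y hy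
    have h4 : F μ y ≠ 0 := by linarith
    positivity
  refine ⟨fun x hx y hy => Real.sqrt_pos.2 (hpos x hx y hy), ?_⟩
  rintro ⟨x, y⟩ ⟨hx, hy⟩
  obtain ⟨h1, h2, h3⟩ := key x hx y hy
  apply DifferentiableAt.differentiableWithinAt
  have hFx : DifferentiableAt ℝ (fun z : ℝ × ℝ => F μ z.1) (x, y) := by unfold F; fun_prop
  have hFy : DifferentiableAt ℝ (fun z : ℝ × ℝ => F μ z.2) (x, y) := by unfold F; fun_prop
  refine DifferentiableAt.sqrt (DifferentiableAt.fun_mul ?_ ?_) (hpos x hx y hy).ne'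
  · have hq : DifferentiableAt ℝ (fun z : ℝ × ℝ => F μ z.1 / -F μ z.2) (x, y) := by
      simp only [div_eq_mul_inv]
      exact hFx.fun_mul (hFy.fun_neg.fun_inv h2.ne')
    exact hq.sqrt (div_pos h1 h2).ne'
  · have hn : DifferentiableAt ℝ (fun z : ℝ × ℝ => R ^ 2 * F μ z.2 ^ 2 * F μ z.1) (x, y) := by
      fun_prop
    have hd : DifferentiableAt ℝ (fun z : ℝ × ℝ => (z.1 - z.2) ^ 2) (x, y) := by fun_prop
    simp only [div_eq_mul_inv]
    exact hn.fun_mul (hd.fun_inv (pow_ne_zero 2 h3))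

/-! ### Kaluza–Klein reduction -/

lemma dotProduct_diagonal_mulVec_four (d v : Fin 4 → ℝ) :
    v ⬝ᵥ (Matrix.diagonal d).mulVec v
      = d 0 * v 0 ^ 2 + d 1 * v 1 ^ 2 + d 2 * v 2 ^ 2 + d 3 * v 3 ^ 2 := by
  simp only [Matrix.mulVec_diagonal, dotProduct, Fin.sum_univ_four]
  ring

/-- The second identity cancels the inner square root in Λ², which leaves a rational identity for
the line element. -/
lemma exp_ringPhi {μ : ℝ} {p : Fin 4 → ℝ} (hx : 0 < F μ (p 2)) (hy : F μ (p 0) < 0) :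
    Real.exp (-2 * ringPhi μ p / √3) = F μ (p 2) / -F μ (p 0) ∧
    Real.exp (ringPhi μ p / √3) * √(F μ (p 2) / -F μ (p 0)) = 1 := by
  have hpos : 0 < F μ (p 2) / -F μ (p 0) := div_pos hx (neg_pos.2 hy)
  have h3 : √(3 : ℝ) ≠ 0 := by positivity
  have e1 : -2 * ringPhi μ p / √3 = Real.log (F μ (p 2) / -F μ (p 0)) := by
    unfold ringPhi; field_simp
  have e2 : ringPhi μ p / √3 = -Real.log (√(F μ (p 2) / -F μ (p 0))) := by
    rw [Real.log_sqrt hpos.le]; unfold ringPhi; field_simp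
  have hs := Real.sqrt_pos.2 hpos
  rw [e1, e2, Real.exp_log hpos, Real.exp_neg, Real.exp_log hs, inv_mul_cancel₀ hs.ne']
  exact ⟨rfl, rfl⟩

lemma isKaluzaKleinReduction_ringMetric {μ lam ν R : ℝ} (hν0 : 0 < ν) (hνlam : ν ≤ lam)
    (hlamμ : lam ≤ μ) (hμ : μ < 1) :
    IsKaluzaKleinReduction (ringMetric μ lam ν R) (reducedMetric μ lam ν (ringFactor μ R))
      (ringPhi μ) (gaugeA lam ν R) (ergoregion ν) := by
  intro p hp
  have hνμ := hνlam.trans hlamμ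
  have hGx := (G_pos_of_mem_Ioo (hν0.trans_le hνlam) (hlamμ.trans_lt hμ) hν0 (hνμ.trans_lt hμ)
    hp.2).ne'
  have hGy := (G_neg_of_lt hν0 (hνμ.trans_lt hμ) hνlam hp.1).ne
  have hx := F_pos_of_mem_Ioo (hν0.trans_le hνμ) hμ hp.2
  have hy := F_neg_of_lt hν0 hνμ hp.1
  obtain ⟨e1, e2⟩ := exp_ringPhi hx hy
  refine ⟨by simp [reducedMetric], fun t v => ?_⟩
  have hL : Real.exp (ringPhi μ p / √3) * ringFactor μ R (p 2) (p 0) ^ 2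
      = R ^ 2 * F μ (p 0) ^ 2 * F μ (p 2) / (p 2 - p 0) ^ 2 := by
    rw [ringFactor_sq hx, ← mul_assoc, e2, one_mul]
  have hred : Real.exp (ringPhi μ p / √3) * (Fin.tail v ⬝ᵥ
        (reducedMetric μ lam ν (ringFactor μ R) p *ᵥ Fin.tail v))
      = (R ^ 2 * F μ (p 0) ^ 2 * F μ (p 2) / (p 2 - p 0) ^ 2) *
        (-(1 / G lam ν (p 0)) * v 1 ^ 2 - G lam ν (p 0) / F μ (p 0) ^ 3 * v 2 ^ 2
          + 1 / G lam ν (p 2) * v 3 ^ 2 + G lam ν (p 2) / F μ (p 2) ^ 3 * v 4 ^ 2) := by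
    rw [← hL]
    rw [reducedMetric, Matrix.smul_mulVec, dotProduct_smul, smul_eq_mul,
      dotProduct_diagonal_mulVec_four]
    simp [Fin.tail]
    ring
  rw [e1, hred]
  have h3 : (Fin.cons t p : Fin 5 → ℝ) 3 = p 2 := rfl
  simp [ringMetric, gaugeA, h3, dotProduct, Matrix.mulVec, Fin.sum_univ_five, Fin.sum_univ_four,
    Fin.tail, Matrix.diagonal_apply]
  have hx' := hx.ne'
  have hy' := hy.ne
  have hd := sub_ne_zero_of_lt hν0 (hνμ.trans_lt hμ) hp.2 hp.1
  field_simp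
  ring

/-- A Kaluza–Klein reduction is determined by the metric. -/
lemma IsKaluzaKleinReduction.unique {n : ℕ} {g : Tensor2 (n + 1)} {h h' : Tensor2 n}
    {Φ Φ' : (Fin n → ℝ) → ℝ} {A A' : (Fin n → ℝ) → Fin n → ℝ} {U : Set (Fin n → ℝ)}
    (H : IsKaluzaKleinReduction g h Φ A U) (H' : IsKaluzaKleinReduction g h' Φ' A' U)
    {p : Fin n → ℝ} (hp : p ∈ U) : h p = h' p ∧ Φ p = Φ' p ∧ A p = A' p := by
  obtain ⟨hs, H⟩ := H p hp
  obtain ⟨hs', H'⟩ := H' p hp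
  have key : ∀ (c : ℝ) (w : Fin n → ℝ),
      Real.exp (Φ p / √3) * (w ⬝ᵥ (h p *ᵥ w)) + Real.exp (-2 * Φ p / √3) * (c + A p ⬝ᵥ w) ^ 2
        = Real.exp (Φ' p / √3) * (w ⬝ᵥ (h' p *ᵥ w))
          + Real.exp (-2 * Φ' p / √3) * (c + A' p ⬝ᵥ w) ^ 2 := by
    intro c w
    have := (H 0 (Fin.cons c w)).symm.trans (H' 0 (Fin.cons c w))
    simpa using this
  -- The vector ∂_t alone isolates the scalar.
  have hΦ : Φ p = Φ' p := by
    have := key 1 0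
    simp at this
    have h3 : √(3 : ℝ) ≠ 0 := by positivity
    simpa [h3, div_left_inj'] using this
  rw [← hΦ] at key
  -- Subtracting the cases c = 1 and c = -1 removes every even term and leaves the cross term, which
  -- is linear in A.
  have hA : ∀ w, A p ⬝ᵥ w = A' p ⬝ᵥ w := by
    intro w
    have h1 := key 1 w
    have h2 := key (-1) w
    have hE := Real.exp_pos (-2 * Φ p / √3)
    have : Real.exp (-2 * Φ p / √3) * (A p ⬝ᵥ w - A' p ⬝ᵥ w) = 0 := by linarith
    rcases mul_eq_zero.1 this with h | h <;> linarith
  have hA' : A p = A' p := dotProduct_eq _ _ hA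
  refine ⟨?_, hΦ, hA'⟩
  have hq : ∀ w, w ⬝ᵥ (h p *ᵥ w) = w ⬝ᵥ (h' p *ᵥ w) := by
    intro w
    have h1 := key 0 w
    rw [hA'] at h1
    exact mul_left_cancel₀ (Real.exp_pos (Φ p / √3)).ne' (add_right_cancel h1)
  -- Polarization on basis vectors, with both matrices symmetric, recovers the entries from the
  -- quadratic form.
  ext i j
  have h1 := hq (Pi.single i 1 + Pi.single j 1)
  have h2 := hq (Pi.single i 1)
  have h3 := hq (Pi.single j 1)
  have e1 : h p j i = h p i j := congrFun (congrFun hs i) j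
  have e2 : h' p j i = h' p i j := congrFun (congrFun hs' i) j
  simp [Matrix.mulVec_add, add_dotProduct] at h1 h2 h3
  linarith

/-! ### Momenta -/

/-- The inverse of `e θ ⊗ θ + diag(0, d₁, d₂, d₃, d₄)` with `θ = (1, 0, a, 0, 0)`, as a quadratic
form on the covectors with vanishing first component. -/
lemma dotProduct_inv_mulVec_of_fibration {e a d₁ d₂ d₃ d₄ : ℝ} (he : e ≠ 0) (h₁ : d₁ ≠ 0)
    (h₂ : d₂ ≠ 0) (h₃ : d₃ ≠ 0) (h₄ : d₄ ≠ 0) {P : Fin 5 → ℝ} (hP : P 0 = 0) :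
    P ⬝ᵥ (e • Matrix.vecMulVec ![1, 0, a, 0, 0] ![1, 0, a, 0, 0]
        + Matrix.diagonal ![0, d₁, d₂, d₃, d₄])⁻¹.mulVec P
      = P 1 ^ 2 / d₁ + P 2 ^ 2 / d₂ + P 3 ^ 2 / d₃ + P 4 ^ 2 / d₄ := by
  -- The coframe θ, dψ has dual frame ∂_t, ∂_ψ - a ∂_t, so the (t, ψ) part of the inverse is ∂_t²/e
  -- + (∂_ψ - a ∂_t)²/d₂. For P 0 = 0 the entries containing a do not contribute.
  have hinv : (e • Matrix.vecMulVec ![1, 0, a, 0, 0] ![1, 0, a, 0, 0]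
      + Matrix.diagonal ![0, d₁, d₂, d₃, d₄])⁻¹
      = !![1 / e + a ^ 2 / d₂, 0, -(a / d₂), 0, 0;
           0, 1 / d₁, 0, 0, 0;
           -(a / d₂), 0, 1 / d₂, 0, 0;
           0, 0, 0, 1 / d₃, 0;
           0, 0, 0, 0, 1 / d₄] := by
    apply Matrix.inv_eq_right_inv
    ext i j
    fin_cases i <;> fin_cases j <;>
      simp [Matrix.mul_apply, Fin.sum_univ_five, Matrix.diagonal_apply]
    all_goals field_simp
    all_goals ring
  rw [hinv]
  simp [Matrix.mulVec, dotProduct, Fin.sum_univ_five, hP]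
  ring

lemma dotProduct_ringMetric_inv_mulVec {μ lam ν R : ℝ} (hR : R ≠ 0) {q : Fin 5 → ℝ}
    (hxy : q 3 - q 1 ≠ 0) (hFx : F μ (q 3) ≠ 0) (hFy : F μ (q 1) ≠ 0) (hGx : G lam ν (q 3) ≠ 0)
    (hGy : G lam ν (q 1) ≠ 0) {P : Fin 5 → ℝ} (hP : P 0 = 0) :
    P ⬝ᵥ (ringMetric μ lam ν R q)⁻¹.mulVec P
      = (q 3 - q 1) ^ 2 / (R ^ 2 * F μ (q 3) * F μ (q 1) ^ 2) *
        ((G lam ν (q 3) * P 3 ^ 2 + F μ (q 3) ^ 3 / G lam ν (q 3) * P 4 ^ 2)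
          - (G lam ν (q 1) * P 1 ^ 2 + F μ (q 1) ^ 3 / G lam ν (q 1) * P 2 ^ 2)) := by
  have hr : R ^ 2 / (q 3 - q 1) ^ 2 ≠ 0 := by positivity
  have hg : ringMetric μ lam ν R q
      = (-(F μ (q 3) / F μ (q 1))) • Matrix.vecMulVec ![1, 0, R * √(lam * ν) * (1 + q 1), 0, 0]
          ![1, 0, R * √(lam * ν) * (1 + q 1), 0, 0]
        + Matrix.diagonal ![0,
          R ^ 2 / (q 3 - q 1) ^ 2 * -(F μ (q 3) * (F μ (q 1) ^ 2 / G lam ν (q 1))),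
          R ^ 2 / (q 3 - q 1) ^ 2 * -(F μ (q 3) * (G lam ν (q 1) / F μ (q 1))),
          R ^ 2 / (q 3 - q 1) ^ 2 * (F μ (q 1) ^ 2 * (F μ (q 3) / G lam ν (q 3))),
          R ^ 2 / (q 3 - q 1) ^ 2 * (F μ (q 1) ^ 2 * (G lam ν (q 3) / F μ (q 3) ^ 2))] := by
    simp only [ringMetric, ← Matrix.diagonal_smul]
    congr 2
    ext i
    fin_cases i <;> simp
  rw [hg, dotProduct_inv_mulVec_of_fibration (by simp [*]) (by simp [*]) (by simp [*])
    (by simp [*]) (by simp [*]) hP]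
  field_simp
  ring

lemma reducedMetric_inv {μ lam ν : ℝ} {Λ : ℝ → ℝ → ℝ} {p : Fin 4 → ℝ} (hΛ : Λ (p 2) (p 0) ≠ 0)
    (hFx : F μ (p 2) ≠ 0) (hFy : F μ (p 0) ≠ 0) (hGx : G lam ν (p 2) ≠ 0)
    (hGy : G lam ν (p 0) ≠ 0) :
    K1 μ lam ν p - K2 μ lam ν p
      = (Λ (p 2) (p 0) ^ 2) • (reducedMetric μ lam ν Λ p)⁻¹ := by
  have : (reducedMetric μ lam ν Λ p)⁻¹
      = (Λ (p 2) (p 0) ^ 2)⁻¹ • (K1 μ lam ν p - K2 μ lam ν p) := by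
    apply Matrix.inv_eq_right_inv
    ext i j
    fin_cases i <;> fin_cases j <;>
      simp [reducedMetric, K1, K2, hΛ, hFx, hFy, hGx, hGy]
  rw [this, smul_smul, mul_inv_cancel₀ (pow_ne_zero 2 hΛ), one_smul]

lemma dotProduct_K1_mulVec (μ lam ν : ℝ) (p P : Fin 4 → ℝ) :
    P ⬝ᵥ (K1 μ lam ν p).mulVec P
      = G lam ν (p 2) * P 2 ^ 2 + F μ (p 2) ^ 3 / G lam ν (p 2) * P 3 ^ 2 := by
  simp [K1, dotProduct_diagonal_mulVec_four]

lemma dotProduct_K2_mulVec (μ lam ν : ℝ) (p P : Fin 4 → ℝ) :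
    P ⬝ᵥ (K2 μ lam ν p).mulVec P
      = G lam ν (p 0) * P 0 ^ 2 + F μ (p 0) ^ 3 / G lam ν (p 0) * P 1 ^ 2 := by
  simp [K2, dotProduct_diagonal_mulVec_four]

/-- Along each coordinate line the action is one summand plus a constant, and `deriv` ignores the
constant even where it takes its default value 0. -/
lemma pd_separableAction (pφ pψ : ℝ) (Sx Sy : ℝ → ℝ) (s : ℝ) (q : Fin 5 → ℝ) (a : Fin 5) :
    pd a (separableAction 0 0 pφ pψ Sx Sy s) q
      = ![0, deriv Sy (q 1), pψ, deriv Sx (q 3), pφ] a := by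
  fin_cases a <;> simp [pd, separableAction, Function.update]

lemma isHamiltonJacobiSolution_iff {μ lam ν R : ℝ} (hR : R ≠ 0) {U : Set (Fin 5 → ℝ)}
    (hU : ∀ q ∈ U, q 3 - q 1 ≠ 0 ∧ F μ (q 3) ≠ 0 ∧ F μ (q 1) ≠ 0 ∧ G lam ν (q 3) ≠ 0 ∧
      G lam ν (q 1) ≠ 0) (pφ pψ : ℝ) (Sx Sy : ℝ → ℝ) :
    IsHamiltonJacobiSolution (ringMetric μ lam ν R) (separableAction 0 0 pφ pψ Sx Sy) U ↔
      ∀ q ∈ U, G lam ν (q 1) * deriv Sy (q 1) ^ 2 + F μ (q 1) ^ 3 / G lam ν (q 1) * pψ ^ 2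
        = G lam ν (q 3) * deriv Sx (q 3) ^ 2 + F μ (q 3) ^ 3 / G lam ν (q 3) * pφ ^ 2 := by
  have key : ∀ (s : ℝ) (q : Fin 5 → ℝ), q ∈ U →
      (deriv (fun r => separableAction 0 0 pφ pψ Sx Sy r q) s
        + (1 / 2) * ∑ a, ∑ b, (ringMetric μ lam ν R q)⁻¹ a b
          * pd a (separableAction 0 0 pφ pψ Sx Sy s) q
          * pd b (separableAction 0 0 pφ pψ Sx Sy s) q = 0 ↔
      G lam ν (q 1) * deriv Sy (q 1) ^ 2 + F μ (q 1) ^ 3 / G lam ν (q 1) * pψ ^ 2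
        = G lam ν (q 3) * deriv Sx (q 3) ^ 2 + F μ (q 3) ^ 3 / G lam ν (q 3) * pφ ^ 2) := by
    intro s q hq
    obtain ⟨hxy, hFx, hFy, hGx, hGy⟩ := hU q hq
    have hd : deriv (fun r => separableAction 0 0 pφ pψ Sx Sy r q) s = 0 := by
      simp [separableAction]
    have hsum : ∑ a, ∑ b, (ringMetric μ lam ν R q)⁻¹ a b
          * pd a (separableAction 0 0 pφ pψ Sx Sy s) q
          * pd b (separableAction 0 0 pφ pψ Sx Sy s) q
        = ![0, deriv Sy (q 1), pψ, deriv Sx (q 3), pφ] ⬝ᵥ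
          (ringMetric μ lam ν R q)⁻¹.mulVec ![0, deriv Sy (q 1), pψ, deriv Sx (q 3), pφ] := by
      simp only [pd_separableAction, dotProduct, Matrix.mulVec, Finset.mul_sum]
      refine Finset.sum_congr rfl fun a _ => Finset.sum_congr rfl fun b _ => by ring
    have hpre : (q 3 - q 1) ^ 2 / (R ^ 2 * F μ (q 3) * F μ (q 1) ^ 2) ≠ 0 :=
      div_ne_zero (pow_ne_zero 2 hxy) (mul_ne_zero (mul_ne_zero (pow_ne_zero 2 hR) hFx)
        (pow_ne_zero 2 hFy))
    rw [hd, hsum, dotProduct_ringMetric_inv_mulVec hR hxy hFx hFy hGx hGy (by simp), zero_add,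
      mul_eq_zero, mul_eq_zero, sub_eq_zero]
    simp [hpre, eq_comm]
  exact ⟨fun H q hq => (key 0 q hq).1 (H 0 q hq), fun H s q hq => (key s q hq).2 (H q hq)⟩

/-! ### The reduced metric as a conformally separable metric -/

section

variable {μ lam ν : ℝ} {Λ : ℝ → ℝ → ℝ} {p : Fin 4 → ℝ}

lemma sq_sqrt_F_cube {x : ℝ} (hx : 0 < F μ x) : √(F μ x ^ 3) ^ 2 = F μ x ^ 3 :=
  Real.sq_sqrt (by positivity)

lemma sq_sqrt_neg_F_cube {y : ℝ} (hy : F μ y < 0) : √(-F μ y ^ 3) ^ 2 = -F μ y ^ 3 :=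
  Real.sq_sqrt (by nlinarith [pow_pos (neg_pos.2 hy) 3])

lemma sqrt_F_cube_pos {x : ℝ} (hx : 0 < F μ x) : 0 < √(F μ x ^ 3) :=
  Real.sqrt_pos.2 (pow_pos hx 3)

lemma sqrt_neg_F_cube_pos {y : ℝ} (hy : F μ y < 0) : 0 < √(-F μ y ^ 3) :=
  Real.sqrt_pos.2 (by nlinarith [pow_pos (neg_pos.2 hy) 3])

/-- Since F(y) < 0, the coefficient -G(y)/F(y)³ equals b/w² with w² = -F(y)³. -/
lemma reducedMetric_eq_sepMetric (hx : 0 < F μ (p 2)) (hy : F μ (p 0) < 0) :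
    reducedMetric μ lam ν Λ p
      = sepMetric Λ (G lam ν) (fun x => √(F μ x ^ 3)) (G lam ν) (fun y => √(-F μ y ^ 3)) p := by
  simp only [reducedMetric, sepMetric, sepDiag, ← Matrix.diagonal_smul, sq_sqrt_F_cube hx,
    sq_sqrt_neg_F_cube hy]
  congr 1
  ext i
  fin_cases i <;> simp [div_eq_mul_inv, mul_assoc]

lemma lower_KUp_eq_sepKilling (hx : 0 < F μ (p 2)) (hy : F μ (p 0) < 0)
    (hGx : G lam ν (p 2) ≠ 0) (hGy : G lam ν (p 0) ≠ 0) :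
    lower (reducedMetric μ lam ν Λ) (KUp μ lam ν) p
      = sepKilling Λ (G lam ν) (fun x => √(F μ x ^ 3)) (G lam ν) (fun y => √(-F μ y ^ 3)) p := by
  have hx' := hx.ne'
  have hy' := hy.ne
  simp only [lower, reducedMetric_eq_sepMetric hx hy, KUp, Pi.add_apply, K1, K2,
    Matrix.diagonal_add, sepMetric, sepDiag, Matrix.diagonal_transpose,
    Matrix.diagonal_mul_diagonal, sepKilling, sepKillingDiag, sq_sqrt_F_cube hx, sq_sqrt_neg_F_cube hy]
  congr 1
  ext i
  fin_cases i <;> simp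
  all_goals field_simp

lemma kForm_eq_sepYano :
    kForm μ Λ p = sepYano Λ (fun x => √(F μ x ^ 3)) (fun y => √(-F μ y ^ 3)) p := by
  ext i j
  fin_cases i <;> fin_cases j <;> simp [kForm, sepYano, wedge, Matrix.single, div_eq_mul_inv]

/-- The opposite relative sign of the two area forms is absorbed into w. -/
lemma kDualForm_eq_sepYano :
    kDualForm μ Λ p = sepYano Λ (fun x => √(F μ x ^ 3)) (fun y => -√(-F μ y ^ 3)) p := by
  ext i j
  fin_cases i <;> fin_cases j <;>
    simp [kDualForm, sepYano, wedge, Matrix.single, div_eq_mul_inv]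

lemma KUp_eq_kUp_mul (hx : 0 < F μ (p 2)) (hy : F μ (p 0) < 0) (hΛ : Λ (p 2) (p 0) ≠ 0)
    (hGx : G lam ν (p 2) ≠ 0) (hGy : G lam ν (p 0) ≠ 0) :
    KUp μ lam ν p = kUp μ Λ p * reducedMetric μ lam ν Λ p * (kUp μ Λ p)ᵀ := by
  have hu := (sqrt_F_cube_pos hx).ne'
  have hw := (sqrt_neg_F_cube_pos hy).ne'
  have eu := sq_sqrt_F_cube hx
  have ew : F μ (p 0) ^ 3 = -√(-F μ (p 0) ^ 3) ^ 2 := by rw [sq_sqrt_neg_F_cube hy, neg_neg]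
  rw [reducedMetric_eq_sepMetric hx hy]
  simp only [KUp, Pi.add_apply, K1, K2, kUp, sepMetric, sepDiag]
  -- With F(x)³ = V² and F(y)³ = -W² the claim becomes a rational identity free of roots.
  generalize √(F μ (p 2) ^ 3) = V at *
  generalize √(-F μ (p 0) ^ 3) = W at *
  rw [← eu, ew]
  ext i j
  fin_cases i <;> fin_cases j <;>
    simp [wedge, Matrix.mul_apply, Matrix.single]
  all_goals field_simp

lemma lower_kUp (hx : 0 < F μ (p 2)) (hy : F μ (p 0) < 0) (hΛ : Λ (p 2) (p 0) ≠ 0)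
    (hGx : G lam ν (p 2) ≠ 0) (hGy : G lam ν (p 0) ≠ 0) :
    lower (reducedMetric μ lam ν Λ) (kUp μ Λ) p = kForm μ Λ p := by
  have hu := (sqrt_F_cube_pos hx).ne'
  have hw := (sqrt_neg_F_cube_pos hy).ne'
  rw [lower, reducedMetric_eq_sepMetric hx hy, kForm_eq_sepYano]
  ext i j
  fin_cases i <;> fin_cases j <;>
    simp [kUp, sepMetric, sepDiag, sepYano, wedge, Matrix.single]
  all_goals field_simp

/-! ### Hodge duality -/

lemma det_fin_four (M : Matrix (Fin 4) (Fin 4) ℝ) :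
    M.det =
    M 0 0 * (M 1 1 * M 2 2 * M 3 3 - M 1 1 * M 2 3 * M 3 2 - M 1 2 * M 2 1 * M 3 3
        + M 1 2 * M 2 3 * M 3 1 + M 1 3 * M 2 1 * M 3 2 - M 1 3 * M 2 2 * M 3 1)
    - M 0 1 * (M 1 0 * M 2 2 * M 3 3 - M 1 0 * M 2 3 * M 3 2 - M 1 2 * M 2 0 * M 3 3
        + M 1 2 * M 2 3 * M 3 0 + M 1 3 * M 2 0 * M 3 2 - M 1 3 * M 2 2 * M 3 0)
    + M 0 2 * (M 1 0 * M 2 1 * M 3 3 - M 1 0 * M 2 3 * M 3 1 - M 1 1 * M 2 0 * M 3 3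
        + M 1 1 * M 2 3 * M 3 0 + M 1 3 * M 2 0 * M 3 1 - M 1 3 * M 2 1 * M 3 0)
    - M 0 3 * (M 1 0 * M 2 1 * M 3 2 - M 1 0 * M 2 2 * M 3 1 - M 1 1 * M 2 0 * M 3 2
        + M 1 1 * M 2 2 * M 3 0 + M 1 2 * M 2 0 * M 3 1 - M 1 2 * M 2 1 * M 3 0) := by
  rw [Matrix.det_succ_row_zero]
  simp [Fin.sum_univ_four, Matrix.det_fin_three, Fin.succAbove]
  ring

/-- The raised form has only yψ and xφ components, so these four index pairs are all that the dual
needs. -/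
lemma leviCivita_pairs (i j : Fin 4) :
    (leviCivita i j 0 1 = wedge 2 3 i j ∧ leviCivita i j 1 0 = -wedge 2 3 i j) ∧
    (leviCivita i j 2 3 = wedge 0 1 i j ∧ leviCivita i j 3 2 = -wedge 0 1 i j) := by
  simp only [leviCivita, det_fin_four, wedge, Matrix.of_apply]
  fin_cases i <;> fin_cases j <;> simp

lemma raise_kForm (hx : 0 < F μ (p 2)) (hy : F μ (p 0) < 0) (hΛ : Λ (p 2) (p 0) ≠ 0)
    (hGx : G lam ν (p 2) ≠ 0) (hGy : G lam ν (p 0) ≠ 0) :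
    raise (reducedMetric μ lam ν Λ) (kForm μ Λ) p = kUp μ Λ p := by
  have hdet : IsUnit (reducedMetric μ lam ν Λ p).det := by
    rw [isUnit_iff_ne_zero, reducedMetric_eq_sepMetric hx hy, sepMetric, Matrix.det_diagonal,
      Fin.prod_univ_four]
    have hu := (sqrt_F_cube_pos hx).ne'
    have hw := (sqrt_neg_F_cube_pos hy).ne'
    simp [sepDiag, *]
  rw [raise, ← lower_kUp hx hy hΛ hGx hGy, lower]
  simp only [Matrix.mul_assoc, ← Matrix.transpose_mul, Matrix.nonsing_inv_mul _ hdet]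
  rw [Matrix.nonsing_inv_mul_cancel_left _ _ hdet]
  simp

/-- In the product of the diagonal entries a and b cancel, leaving -(Λ⁴/(uw))². -/
lemma sqrt_abs_det_reducedMetric (hx : 0 < F μ (p 2)) (hy : F μ (p 0) < 0)
    (hGx : G lam ν (p 2) ≠ 0) (hGy : G lam ν (p 0) ≠ 0) :
    √|(reducedMetric μ lam ν Λ p).det|
      = Λ (p 2) (p 0) ^ 4 / (√(F μ (p 2) ^ 3) * √(-F μ (p 0) ^ 3)) := by
  have hu := sqrt_F_cube_pos hx
  have hw := sqrt_neg_F_cube_pos hy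
  have : (reducedMetric μ lam ν Λ p).det
      = -(Λ (p 2) (p 0) ^ 4 / (√(F μ (p 2) ^ 3) * √(-F μ (p 0) ^ 3))) ^ 2 := by
    rw [reducedMetric_eq_sepMetric hx hy, sepMetric, Matrix.det_diagonal, Fin.prod_univ_four]
    simp only [sepDiag]
    simp
    field_simp
  rw [this, abs_neg, abs_of_nonneg (sq_nonneg _), Real.sqrt_sq (by positivity)]

/-- The density Λ⁴/(uw) times w/Λ or u/Λ gives Λ³/u or Λ³/w on the complementary plane; the two
orderings of each index pair cancel the factor ½. -/
lemma hodgeDual_kForm (hx : 0 < F μ (p 2)) (hy : F μ (p 0) < 0) (hΛ : Λ (p 2) (p 0) ≠ 0)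
    (hGx : G lam ν (p 2) ≠ 0) (hGy : G lam ν (p 0) ≠ 0) :
    hodgeDual (reducedMetric μ lam ν Λ) (kForm μ Λ) p = kDualForm μ Λ p := by
  have hu := sqrt_F_cube_pos hx
  have hw := sqrt_neg_F_cube_pos hy
  ext i j
  obtain ⟨⟨e1, e2⟩, e3, e4⟩ := leviCivita_pairs i j
  simp only [hodgeDual, raise_kForm hx hy hΛ hGx hGy, sqrt_abs_det_reducedMetric hx hy hGx hGy,
    Fin.sum_univ_four, Matrix.of_apply]
  simp [kUp, wedge, Matrix.single, e1, e2, e3, e4]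
  simp [kDualForm, wedge, Matrix.single]
  field_simp
  ring

/-! ### Regularity of the ring data and the reflection w ↦ -w -/

lemma IsConformalFactor.isRegularAt (hΛ : IsConformalFactor ν Λ) (hp : p ∈ ergoregion ν)
    (hx : 0 < F μ (p 2)) (hy : F μ (p 0) < 0) (hGx : G lam ν (p 2) ≠ 0)
    (hGy : G lam ν (p 0) ≠ 0) :
    IsRegularAt Λ (G lam ν) (fun x => √(F μ x ^ 3)) (G lam ν) (fun y => √(-F μ y ^ 3)) p := by
  have hd : DifferentiableAt ℝ (fun z : ℝ × ℝ => Λ z.1 z.2) (p 2, p 0) :=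
    (hΛ.2 (p 2, p 0) ⟨hp.2, hp.1⟩).differentiableAt
      ((isOpen_Ioo.prod isOpen_Ioi).mem_nhds ⟨hp.2, hp.1⟩)
  have hF : Differentiable ℝ (F μ) := by unfold F; fun_prop
  have hG : Differentiable ℝ (G lam ν) := by unfold G; fun_prop
  exact
    { Λ_ne := (hΛ.1 _ hp.2 _ hp.1).ne'
      a_ne := hGx
      u_ne := (sqrt_F_cube_pos hx).ne'
      b_ne := hGy
      w_ne := (sqrt_neg_F_cube_pos hy).ne'
      Λ_diff_x := hd.comp (p 2) (f := fun s => (s, p 0)) (by fun_prop)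
      Λ_diff_y := hd.comp (p 0) (f := fun s => (p 2, s)) (by fun_prop)
      a_diff := hG _
      u_diff := (hF.fun_pow 3 _).sqrt (pow_pos hx 3).ne'
      b_diff := hG _
      w_diff := ((hF.fun_pow 3).fun_neg _).sqrt (neg_ne_zero.2 (pow_ne_zero 3 hy.ne)) }

lemma IsRegularAt.neg {a u b w : ℝ → ℝ} (H : IsRegularAt Λ a u b w p) :
    IsRegularAt Λ a u b (fun y => -w y) p :=
  { H with
    w_ne := neg_ne_zero.2 H.w_ne
    w_diff := H.w_diff.fun_neg }

lemma sepMetric_neg (Λ : ℝ → ℝ → ℝ) (a u b w : ℝ → ℝ) :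
    sepMetric Λ a u b (fun y => -w y) = sepMetric Λ a u b w := by
  funext p
  simp [sepMetric, sepDiag]

end

end DipoleRing

end

/-! ### The main theorem -/

open DipoleRing

theorem mainTheorem7 (μ lam ν R : ℝ) (hν : 0 < ν) (hνlam : ν ≤ lam) (hlamμ : lam ≤ μ)
    (hμ : μ < 1) (hR : R ≠ 0) :
    -- the Kaluza–Klein reduction of the dipole ring along `∂_t`, and its uniqueness
    DipoleRing.IsConformalFactor ν (DipoleRing.ringFactor μ R) ∧
    DipoleRing.IsKaluzaKleinReduction (DipoleRing.ringMetric μ lam ν R)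
      (DipoleRing.reducedMetric μ lam ν (DipoleRing.ringFactor μ R))
      (DipoleRing.ringPhi μ) (DipoleRing.gaugeA lam ν R) (DipoleRing.ergoregion ν) ∧
    (∀ (h : DipoleRing.Tensor2 4) (Φ : (Fin 4 → ℝ) → ℝ) (A : (Fin 4 → ℝ) → Fin 4 → ℝ),
      DipoleRing.IsKaluzaKleinReduction (DipoleRing.ringMetric μ lam ν R) h Φ A
        (DipoleRing.ergoregion ν) →
      ∀ p ∈ DipoleRing.ergoregion ν,
        h p = DipoleRing.reducedMetric μ lam ν (DipoleRing.ringFactor μ R) p ∧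
        Φ p = DipoleRing.ringPhi μ p ∧ A p = DipoleRing.gaugeA lam ν R p) ∧
    -- separability of the Hamilton–Jacobi equation for `m = 0`, `E = 0`
    (∀ (pφ pψ : ℝ) (Sx Sy : ℝ → ℝ), DifferentiableOn ℝ Sx (Set.Ioo (-1) 1) →
      DifferentiableOn ℝ Sy (Set.Ioi (1 / ν)) →
      (DipoleRing.IsHamiltonJacobiSolution (DipoleRing.ringMetric μ lam ν R)
        (DipoleRing.separableAction 0 0 pφ pψ Sx Sy) (DipoleRing.ergoregion5 ν) ↔
      ∃ c : ℝ, ∀ x ∈ Set.Ioo (-1 : ℝ) 1, ∀ y ∈ Set.Ioi (1 / ν),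
        DipoleRing.G lam ν y * deriv Sy y ^ 2
          + DipoleRing.F μ y ^ 3 / DipoleRing.G lam ν y * pψ ^ 2 = c ∧
        DipoleRing.G lam ν x * deriv Sx x ^ 2
          + DipoleRing.F μ x ^ 3 / DipoleRing.G lam ν x * pφ ^ 2 = c)) ∧
    -- `K₍₁₎` and `K₍₂₎` are the quadratic forms in the momenta on the two sides of that equation
    (∀ p ∈ DipoleRing.ergoregion ν, ∀ py pψ px pφ : ℝ,
      ![py, pψ, px, pφ] ⬝ᵥ (DipoleRing.K1 μ lam ν p).mulVec ![py, pψ, px, pφ]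
        = DipoleRing.G lam ν (p 2) * px ^ 2
          + DipoleRing.F μ (p 2) ^ 3 / DipoleRing.G lam ν (p 2) * pφ ^ 2 ∧
      ![py, pψ, px, pφ] ⬝ᵥ (DipoleRing.K2 μ lam ν p).mulVec ![py, pψ, px, pφ]
        = DipoleRing.G lam ν (p 0) * py ^ 2
          + DipoleRing.F μ (p 0) ^ 3 / DipoleRing.G lam ν (p 0) * pψ ^ 2) ∧
    -- zero-energy null momenta of the ring are the null momenta of the reduced metric
    (∀ q ∈ DipoleRing.ergoregion5 ν, ∀ P : Fin 5 → ℝ, P 0 = 0 →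
      (P ⬝ᵥ (DipoleRing.ringMetric μ lam ν R q)⁻¹.mulVec P = 0 ↔
        Fin.tail P ⬝ᵥ (DipoleRing.reducedMetric μ lam ν (DipoleRing.ringFactor μ R)
          (Fin.tail q))⁻¹.mulVec (Fin.tail P) = 0)) ∧
    -- the hidden symmetries, for every conformal factor, in particular for that of the ring
    (∀ Λ : ℝ → ℝ → ℝ, DipoleRing.IsConformalFactor ν Λ →
      -- `K₍₁₎^{ij} - K₍₂₎^{ij} = Λ² h^{ij}`
      (∀ p ∈ DipoleRing.ergoregion ν,
        DipoleRing.K1 μ lam ν p - DipoleRing.K2 μ lam ν p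
          = (Λ (p 2) (p 0) ^ 2) • (DipoleRing.reducedMetric μ lam ν Λ p)⁻¹) ∧
      -- `K = K₍₁₎ + K₍₂₎` satisfies the conformal Killing equation with `ω`
      DipoleRing.IsConformalKilling (DipoleRing.reducedMetric μ lam ν Λ)
        (DipoleRing.lower (DipoleRing.reducedMetric μ lam ν Λ) (DipoleRing.KUp μ lam ν))
        (DipoleRing.omegaForm Λ) (DipoleRing.ergoregion ν) ∧
      -- `K^{ij} = k^{ia} k^{jb} h_{ab}`
      (∀ p ∈ DipoleRing.ergoregion ν,
        DipoleRing.KUp μ lam ν p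
          = DipoleRing.kUp μ Λ p * DipoleRing.reducedMetric μ lam ν Λ p
            * (DipoleRing.kUp μ Λ p).transpose) ∧
      -- lowering the indices of `k^{ij}` gives the 2-form `k`
      (∀ p ∈ DipoleRing.ergoregion ν,
        DipoleRing.lower (DipoleRing.reducedMetric μ lam ν Λ) (DipoleRing.kUp μ Λ) p
          = DipoleRing.kForm μ Λ p) ∧
      -- `k` satisfies the conformal Killing–Yano equation with `ξ`
      DipoleRing.IsConformalKillingYano (DipoleRing.reducedMetric μ lam ν Λ)
        (DipoleRing.kForm μ Λ) (DipoleRing.xiForm μ lam ν Λ) (DipoleRing.ergoregion ν) ∧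
      -- the Hodge dual of `k` has the same form and is again conformal Killing–Yano
      (∀ p ∈ DipoleRing.ergoregion ν,
        DipoleRing.hodgeDual (DipoleRing.reducedMetric μ lam ν Λ) (DipoleRing.kForm μ Λ) p
          = DipoleRing.kDualForm μ Λ p) ∧
      ∃ ξ : (Fin 4 → ℝ) → Fin 4 → ℝ,
        DipoleRing.IsConformalKillingYano (DipoleRing.reducedMetric μ lam ν Λ)
          (DipoleRing.hodgeDual (DipoleRing.reducedMetric μ lam ν Λ) (DipoleRing.kForm μ Λ))
          ξ (DipoleRing.ergoregion ν)) := by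

  have hνμ := hνlam.trans hlamμ
  have hν1 := hνμ.trans_lt hμ
  have hμ0 := hν.trans_le hνμ
  have hFx : ∀ x ∈ Set.Ioo (-1 : ℝ) 1, 0 < F μ x := fun x hx => F_pos_of_mem_Ioo hμ0 hμ hx
  have hFy : ∀ y ∈ Set.Ioi (1 / ν), F μ y < 0 := fun y hy => F_neg_of_lt hν hνμ hy
  have hGx : ∀ x ∈ Set.Ioo (-1 : ℝ) 1, G lam ν x ≠ 0 := fun x hx =>
    (G_pos_of_mem_Ioo (hν.trans_le hνlam) (hlamμ.trans_lt hμ) hν hν1 hx).ne'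
  have hGy : ∀ y ∈ Set.Ioi (1 / ν), G lam ν y ≠ 0 := fun y hy => (G_neg_of_lt hν hν1 hνlam hy).ne
  have hring := isConformalFactor_ringFactor hν hνμ hμ hR
  have hKK := isKaluzaKleinReduction_ringMetric (R := R) hν hνlam hlamμ hμ
  refine ⟨hring, hKK, fun h Φ A H p hp => H.unique hKK hp, ?_, ?_, ?_, ?_⟩
  · intro pφ pψ Sx Sy _ _
    rw [isHamiltonJacobiSolution_iff (U := ergoregion5 ν) hR fun q hq =>
      ⟨sub_ne_zero_of_lt hν hν1 hq.2 hq.1, (hFx _ hq.2).ne', (hFy _ hq.1).ne, hGx _ hq.2,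
        hGy _ hq.1⟩]
    have hy₀ : 1 / ν + 1 ∈ Set.Ioi (1 / ν) := by simp
    constructor
    · intro H
      -- Nothing depends on t, ψ, φ, so they are set to 0, while x and y vary independently.
      have key : ∀ x ∈ Set.Ioo (-1 : ℝ) 1, ∀ y ∈ Set.Ioi (1 / ν), _ := fun x hx y hy =>
        H ![0, y, 0, x, 0] ⟨hy, hx⟩
      -- The separation constant is the x-side at x = 0; comparing through the reference value y =
      -- 1/ν + 1 shows that the x-side is constant.
      refine ⟨G lam ν 0 * deriv Sx 0 ^ 2 + F μ 0 ^ 3 / G lam ν 0 * pφ ^ 2, fun x hx y hy => ?_⟩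
      exact ⟨key 0 (by norm_num) y hy,
        (key x hx _ hy₀).symm.trans (key 0 (by norm_num) _ hy₀)⟩
    · rintro ⟨c, hc⟩ q hq
      obtain ⟨h1, h2⟩ := hc (q 3) hq.2 (q 1) hq.1
      exact h1.trans h2.symm
  · intro p _ py pψ px pφ
    exact ⟨dotProduct_K1_mulVec μ lam ν p _, dotProduct_K2_mulVec μ lam ν p _⟩
  · intro q hq P hP
    have hq' : Fin.tail q ∈ ergoregion ν := hq
    have hxy : q 3 - q 1 ≠ 0 := sub_ne_zero_of_lt hν hν1 hq'.2 hq'.1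
    have h1 : F μ (q 3) ≠ 0 := (hFx _ hq'.2).ne'
    have h2 : F μ (q 1) ≠ 0 := (hFy _ hq'.1).ne
    have h3 : G lam ν (q 3) ≠ 0 := hGx _ hq'.2
    have h4 : G lam ν (q 1) ≠ 0 := hGy _ hq'.1
    have hΛ := (hring.1 _ hq'.2 _ hq'.1).ne'
    -- Evaluating K₍₁₎ - K₍₂₎ = Λ² h⁻¹ on the momentum shows that the bracket in the ring's
    -- quadratic form is Λ² times that of h.
    have e := congrArg (fun M : Matrix (Fin 4) (Fin 4) ℝ => Fin.tail P ⬝ᵥ M.mulVec (Fin.tail P))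
      (reducedMetric_inv (p := Fin.tail q) hΛ h1 h2 h3 h4)
    simp only [Matrix.sub_mulVec, dotProduct_sub, dotProduct_K1_mulVec, dotProduct_K2_mulVec,
      Matrix.smul_mulVec, dotProduct_smul, smul_eq_mul] at e
    rw [dotProduct_ringMetric_inv_mulVec hR hxy h1 h2 h3 h4 hP, mul_eq_zero,
      or_iff_right (div_ne_zero (pow_ne_zero 2 hxy) (mul_ne_zero (mul_ne_zero (pow_ne_zero 2 hR) h1)
        (pow_ne_zero 2 h2)))]
    refine Iff.trans (Eq.congr_left e) ?_
    rw [mul_eq_zero, or_iff_right (pow_ne_zero 2 hΛ)]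
  · intro Λ hΛ
    have hΛ0 : ∀ p ∈ ergoregion ν, Λ (p 2) (p 0) ≠ 0 := fun p hp => (hΛ.1 _ hp.2 _ hp.1).ne'
    have hreg := fun p (hp : p ∈ ergoregion ν) =>
      hΛ.isRegularAt hp (hFx _ hp.2) (hFy _ hp.1) (hGx _ hp.2) (hGy _ hp.1)
    have hU := isOpen_ergoregion ν
    have hmet := fun p (hp : p ∈ ergoregion ν) =>
      reducedMetric_eq_sepMetric (lam := lam) (ν := ν) (Λ := Λ) (hFx _ hp.2) (hFy _ hp.1)
    have hdual := fun p (hp : p ∈ ergoregion ν) =>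
      hodgeDual_kForm (hFx _ hp.2) (hFy _ hp.1) (hΛ0 p hp) (hGx _ hp.2) (hGy _ hp.1)
    refine ⟨fun p hp => ?_, ?_, fun p hp => ?_, fun p hp => ?_, ?_, hdual, ?_⟩
    · exact reducedMetric_inv (hΛ0 p hp) (hFx _ hp.2).ne' (hFy _ hp.1).ne (hGx _ hp.2) (hGy _ hp.1)
    · exact (isConformalKilling_sepKilling hreg).congr hU hmet
        (fun p hp => lower_KUp_eq_sepKilling (hFx _ hp.2) (hFy _ hp.1) (hGx _ hp.2) (hGy _ hp.1))
        fun _ _ => rfl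
    · exact KUp_eq_kUp_mul (hFx _ hp.2) (hFy _ hp.1) (hΛ0 p hp) (hGx _ hp.2) (hGy _ hp.1)
    · exact lower_kUp (hFx _ hp.2) (hFy _ hp.1) (hΛ0 p hp) (hGx _ hp.2) (hGy _ hp.1)
    · exact (isConformalKillingYano_sepYano hreg).congr hU hmet (fun _ _ => kForm_eq_sepYano)
        fun _ _ => rfl
    · refine ⟨sepXi Λ (G lam ν) (fun x => √(F μ x ^ 3)) (G lam ν) (fun y => -√(-F μ y ^ 3)), ?_⟩
      exact (isConformalKillingYano_sepYano fun p hp => (hreg p hp).neg).congr hU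
        (fun p hp => by rw [sepMetric_neg]; exact hmet p hp)
        (fun p hp => (hdual p hp).trans kDualForm_eq_sepYano) fun _ _ => rfl
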